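/- For a Boolean function $f:\{0,1\}^n\times\{0,1\}^n\to\{0,1\}$ let $Q^{pub}(f)$ be the minimal number of qubits communicated by a multi-round two-party quantum protocol in which Alice (holding $x$) and Bob (holding $y$) have unlimited shared randomness but no prior entanglement, and which computes $f$ with error probability at most $1/3$ on every input. Let $Q^{\parallel}(f)$ be the minimal number of qubits sent in a quantum simultaneous message passing (SMP) protocol without shared randomness or entanglement (Alice and Bob each send one quantum message, depending only on their own input, to a referee, who measures and outputs a bit) that computes $f$ with error probability at most $1/3$ on every input. A repeated fingerprinting protocol with $q$-qubit fingerprints and $r$ repetitions is an SMP protocol in which Alice sends $r$ copies of a $q$-qubit pure state $|\alpha_x\rangle$, Bob sends $r$ copies of a $q$-qubit pure state $|\beta_y\rangle$, and the referee performs $r$ swap tests, each of which independently outputs $0$ with probability $\frac12+\frac12|\langle\alpha_x|\beta_y\rangle|^2$, estimates $|\langle\alpha_x|\beta_y\rangle|^2$ from the fraction of outcomes $0$, and outputs $1$ iff the estimate is at least a fixed threshold. Its cost is $2qr$ qubits. Theorem. (1) There is a universal constant $C$ such that for all $n\ge 2$ and all $f:\{0,1\}^n\times\{0,1\}^n\to\{0,1\}$,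 $$Q^{\parallel}(f)\le C\cdot 2^{8Q^{pub}(f)}\log_2 n .$$ (2) The simulation is by repeated fingerprinting: for every $\varepsilon>0$ there is a constant $C_\varepsilon$ such that for all $n\ge 2$, all such $f$, and every shared-randomness multi-round quantum protocol (without prior entanglement) that communicates at most $c$ qubits and computes $f$ with error probability at most $1/3$ on every input, there is a repeated fingerprinting protocol, without shared randomness, that computes $f$ with error probability at most $\varepsilon$ on every input and sends at most $C_\varepsilon\cdot 2^{8c}\log_2 n$ qubits. -/

import Mathlib

open scoped Kronecker ComplexOrder Matrix

noncomputable section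

/-- An effect (the "accept" element of a two-outcome measurement): `0 ≤ E ≤ 1`. -/
def IsEffect {ι : Type} [Fintype ι] [DecidableEq ι] (E : Matrix ι ι ℂ) : Prop :=
  E.PosSemidef ∧ (1 - E).PosSemidef

/-- A density matrix: positive semidefinite with trace one. -/
def IsDensity {ι : Type} [Fintype ι] (ρ : Matrix ι ι ℂ) : Prop :=
  ρ.PosSemidef ∧ ρ.trace = 1

/-- The acceptance probabilities `p x y` compute `f` with error probability at most `ε`
on every input. -/
def ComputesWithError {X Y : Type} (p : X → Y → ℝ) (f : X → Y → Bool) (ε : ℝ) : Prop :=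
  ∀ x y, (f x y = true → 1 - ε ≤ p x y) ∧ (f x y = false → p x y ≤ ε)

/-! ### Interactive two-party quantum protocols -/

/-- `QProtocol X Y a b` is (the remaining part of) a multi-round quantum protocol for Alice
(input in `X`) and Bob (input in `Y`) when Alice currently holds a private register of dimension
`a` and Bob one of dimension `b`.

In a round, one party applies to its register an isometry that depends on its own input only
(adding fresh ancillas and then applying a unitary) and sends `k` qubits of the result to the
other party. In the end one of the parties performs a two-outcome measurement on its own register,
which gives the output bit. The pattern of message lengths does not depend on the inputs. -/
inductive QProtocol (X Y : Type) : ℕ → ℕ → Type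
  | aliceOutput {a b : ℕ} (E : X → Matrix (Fin a) (Fin a) ℂ) (hE : ∀ x, IsEffect (E x)) :
      QProtocol X Y a b
  | bobOutput {a b : ℕ} (E : Y → Matrix (Fin b) (Fin b) ℂ) (hE : ∀ y, IsEffect (E y)) :
      QProtocol X Y a b
  | aliceSend {a b : ℕ} (a' k : ℕ) (V : X → Matrix (Fin a' × Fin (2 ^ k)) (Fin a) ℂ)
      (hV : ∀ x, (V x)ᴴ * V x = 1) (next : QProtocol X Y a' (2 ^ k * b)) :
      QProtocol X Y a b
  | bobSend {a b : ℕ} (b' k : ℕ) (V : Y → Matrix (Fin (2 ^ k) × Fin b') (Fin b) ℂ)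
      (hV : ∀ y, (V y)ᴴ * V y = 1) (next : QProtocol X Y (a * 2 ^ k) b') :
      QProtocol X Y a b

/-- The total number of qubits communicated. -/
def QProtocol.cost {X Y : Type} : {a b : ℕ} → QProtocol X Y a b → ℕ
  | _, _, .aliceOutput _ _ => 0
  | _, _, .bobOutput _ _ => 0
  | _, _, .aliceSend _ k _ _ next => k + next.cost
  | _, _, .bobSend _ k _ _ next => k + next.cost

/-- The joint state after Alice has applied `V` and handed over the message register. -/
def aliceStep {a b a' k : ℕ} (V : Matrix (Fin a' × Fin (2 ^ k)) (Fin a) ℂ)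
    (ψ : Fin a × Fin b → ℂ) : Fin a' × Fin (2 ^ k * b) → ℂ := fun p =>
  let mj := finProdFinEquiv.symm p.2
  ((V ⊗ₖ (1 : Matrix (Fin b) (Fin b) ℂ)) *ᵥ ψ) ((p.1, mj.1), mj.2)

/-- The joint state after Bob has applied `V` and handed over the message register. -/
def bobStep {a b b' k : ℕ} (V : Matrix (Fin (2 ^ k) × Fin b') (Fin b) ℂ)
    (ψ : Fin a × Fin b → ℂ) : Fin (a * 2 ^ k) × Fin b' → ℂ := fun p =>
  let im := finProdFinEquiv.symm p.1
  (((1 : Matrix (Fin a) (Fin a) ℂ) ⊗ₖ V) *ᵥ ψ) (im.1, (im.2, p.2))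

/-- The probability that the protocol outputs `1` on inputs `x`, `y` when run from the joint pure
state `ψ` (Born rule). -/
def QProtocol.acceptFrom {X Y : Type} (x : X) (y : Y) :
    {a b : ℕ} → QProtocol X Y a b → (Fin a × Fin b → ℂ) → ℝ
  | _, b, .aliceOutput E _, ψ =>
      (star ψ ⬝ᵥ ((E x ⊗ₖ (1 : Matrix (Fin b) (Fin b) ℂ)) *ᵥ ψ)).re
  | a, _, .bobOutput E _, ψ =>
      (star ψ ⬝ᵥ (((1 : Matrix (Fin a) (Fin a) ℂ) ⊗ₖ E y) *ᵥ ψ)).re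
  | _, _, .aliceSend _ _ V _ next, ψ => next.acceptFrom x y (aliceStep (V x) ψ)
  | _, _, .bobSend _ _ V _ next, ψ => next.acceptFrom x y (bobStep (V y) ψ)

/-- Acceptance probability of a protocol without prior entanglement: both private registers
start out trivial (one-dimensional). -/
def QProtocol.accept {X Y : Type} (P : QProtocol X Y 1 1) (x : X) (y : Y) : ℝ :=
  P.acceptFrom x y (fun _ => 1)

/-- A multi-round quantum protocol with unlimited shared randomness: the parties jointly draw `r`
from an arbitrary probability space and then run the quantum protocol `run r`. The shared
randomness is free; `cost` bounds the number of qubits communicated for every `r`. -/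
structure SharedRandomnessProtocol (X Y : Type) where
  R : Type
  [measurableSpace : MeasurableSpace R]
  μ : MeasureTheory.Measure R
  [isProbabilityMeasure : MeasureTheory.IsProbabilityMeasure μ]
  run : R → QProtocol X Y 1 1
  measurable_accept : ∀ x y, Measurable fun r => (run r).accept x y
  cost : ℕ
  cost_run_le : ∀ r, (run r).cost ≤ cost

/-- Acceptance probability, averaged over the shared randomness. -/
def SharedRandomnessProtocol.accept {X Y : Type} (P : SharedRandomnessProtocol X Y)
    (x : X) (y : Y) : ℝ :=
  letI := P.measurableSpace
  ∫ r, (P.run r).accept x y ∂P.μ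

/-- `Q^pub(f)`: least cost of a shared-randomness multi-round quantum protocol that computes `f`
with error at most `1/3` on all inputs. -/
def Qpub {X Y : Type} (f : X → Y → Bool) : ℕ :=
  sInf {q | ∃ P : SharedRandomnessProtocol X Y, P.cost = q ∧ ComputesWithError P.accept f (1 / 3)}

/-! ### Simultaneous message passing -/

/-- A quantum SMP protocol without shared resources: Alice sends an `a`-qubit (mixed) state, Bob
a `b`-qubit state, and the referee performs a two-outcome measurement on both messages. -/
structure SMPProtocol (X Y : Type) where
  a : ℕ
  b : ℕ
  ρ : X → Matrix (Fin (2 ^ a)) (Fin (2 ^ a)) ℂ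
  σ : Y → Matrix (Fin (2 ^ b)) (Fin (2 ^ b)) ℂ
  isDensity_ρ : ∀ x, IsDensity (ρ x)
  isDensity_σ : ∀ y, IsDensity (σ y)
  E : Matrix (Fin (2 ^ a) × Fin (2 ^ b)) (Fin (2 ^ a) × Fin (2 ^ b)) ℂ
  isEffect_E : IsEffect E

/-- The number of qubits sent. -/
def SMPProtocol.cost {X Y : Type} (P : SMPProtocol X Y) : ℕ := P.a + P.b

/-- The probability that the referee outputs `1`. -/
def SMPProtocol.accept {X Y : Type} (P : SMPProtocol X Y) (x : X) (y : Y) : ℝ :=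
  (P.E * (P.ρ x ⊗ₖ P.σ y)).trace.re

/-- `Q^∥(f)`: least cost of a quantum SMP protocol (no shared randomness or entanglement) that
computes `f` with error at most `1/3` on all inputs. -/
def Qsmp {X Y : Type} (f : X → Y → Bool) : ℕ :=
  sInf {q | ∃ P : SMPProtocol X Y, P.cost = q ∧ ComputesWithError P.accept f (1 / 3)}

/-! ### Repeated fingerprinting -/

/-- A repeated fingerprinting protocol: Alice sends `r` copies of the `q`-qubit pure state `α x`,
Bob `r` copies of the `q`-qubit pure state `β y`; the referee performs `r` swap tests, estimates
`|⟨α x, β y⟩|²` from the outcomes and outputs `1` iff the estimate is at least `τ`. -/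
structure FingerprintProtocol (X Y : Type) where
  q : ℕ
  r : ℕ
  α : X → EuclideanSpace ℂ (Fin (2 ^ q))
  β : Y → EuclideanSpace ℂ (Fin (2 ^ q))
  norm_α : ∀ x, ‖α x‖ = 1
  norm_β : ∀ y, ‖β y‖ = 1
  τ : ℝ

namespace FingerprintProtocol

variable {X Y : Type} (F : FingerprintProtocol X Y)

/-- The number of qubits sent: `r` copies of a `q`-qubit state from each party. -/
def cost : ℕ := 2 * F.q * F.r

/-- The probability of the outcome `z` (`false` is the outcome 0) of one swap test. -/
def swapTest (x : X) (y : Y) (z : Bool) : ℝ :=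
  if z then 1 / 2 - ‖inner ℂ (F.α x) (F.β y)‖ ^ 2 / 2
  else 1 / 2 + ‖inner ℂ (F.α x) (F.β y)‖ ^ 2 / 2

/-- The estimate of `|⟨α x, β y⟩|²`: twice the fraction of outcomes 0, minus one. -/
def estimate (z : Fin F.r → Bool) : ℝ :=
  2 * ((Finset.univ.filter fun i => z i = false).card / F.r : ℝ) - 1

open Classical in
/-- The probability that the referee outputs `1`; the `r` swap tests are independent. -/
def accept (x : X) (y : Y) : ℝ :=
  ∑ z : Fin F.r → Bool, if F.τ ≤ F.estimate z then ∏ i, F.swapTest x y (z i) else 0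

end FingerprintProtocol

/-! ### The two complexity measures are minima over nonempty sets -/

/-- A projection onto basis states is an effect. -/
theorem isEffect_diagonal {ι : Type} [Fintype ι] [DecidableEq ι] (g : ι → Bool) :
    IsEffect (Matrix.diagonal fun i => if g i then (1 : ℂ) else 0) := by
  constructor
  · refine Matrix.PosSemidef.diagonal fun i => ?_
    by_cases h : g i <;> simp [h]
  · rw [← Matrix.diagonal_one, Matrix.diagonal_sub]
    refine Matrix.PosSemidef.diagonal fun i => ?_
    by_cases h : g i <;> simp [h]

def bitsEquiv (n : ℕ) : (Fin n → Bool) ≃ Fin (2 ^ n) :=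
  Fintype.equivFinOfCardEq (by simp)

/-- Sending both inputs to the referee works: the set defining `Qsmp` is nonempty. -/
theorem exists_SMPProtocol {n : ℕ} (f : (Fin n → Bool) → (Fin n → Bool) → Bool) :
    ∃ P : SMPProtocol (Fin n → Bool) (Fin n → Bool),
      P.cost = n + n ∧ ComputesWithError P.accept f (1 / 3) := by
  have hd : ∀ x : Fin n → Bool, IsDensity
      (Matrix.diagonal fun i => if i = bitsEquiv n x then (1 : ℂ) else 0) := by
    intro x
    constructor
    · refine Matrix.PosSemidef.diagonal fun i => ?_
      by_cases h : i = bitsEquiv n x <;> simp [h]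
    · simp [Matrix.trace_diagonal]
  refine ⟨⟨n, n, _, _, hd, hd, _, isEffect_diagonal fun p =>
    f ((bitsEquiv n).symm p.1) ((bitsEquiv n).symm p.2)⟩, rfl, fun x y => ?_⟩
  have : SMPProtocol.accept ⟨n, n, _, _, hd, hd, _, isEffect_diagonal fun p =>
    f ((bitsEquiv n).symm p.1) ((bitsEquiv n).symm p.2)⟩ x y = if f x y then 1 else 0 := by
    simp only [SMPProtocol.accept, Matrix.diagonal_kronecker_diagonal,
      Matrix.diagonal_mul_diagonal, Matrix.trace_diagonal, Fintype.sum_prod_type]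
    rw [Finset.sum_eq_single (bitsEquiv n x), Finset.sum_eq_single (bitsEquiv n y)]
    · by_cases h : f x y <;> simp [h]
    · intro b _ hb; simp [hb]
    · simp
    · intro b _ hb; simp [hb]
    · simp
  rw [this]
  constructor <;> intro h <;> norm_num [h]

/-- Sending Alice's input to Bob works: the set defining `Qpub` is nonempty. -/
theorem exists_SharedRandomnessProtocol {n : ℕ} (f : (Fin n → Bool) → (Fin n → Bool) → Bool) :
    ∃ P : SharedRandomnessProtocol (Fin n → Bool) (Fin n → Bool),
      P.cost = n ∧ ComputesWithError P.accept f (1 / 3) := by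
  let V : (Fin n → Bool) → Matrix (Fin 1 × Fin (2 ^ n)) (Fin 1) ℂ :=
    fun x => Matrix.of fun p _ => if p.2 = bitsEquiv n x then 1 else 0
  have hV : ∀ x, (V x)ᴴ * V x = 1 := by
    intro x
    ext i j
    have : i = j := Subsingleton.elim _ _
    subst this
    simp [V, Matrix.mul_apply, Fintype.sum_prod_type, Matrix.conjTranspose_apply]
  let P : QProtocol (Fin n → Bool) (Fin n → Bool) 1 1 :=
    .aliceSend 1 n V hV (.bobOutput _ fun y => isEffect_diagonal fun p =>
      f ((bitsEquiv n).symm (finProdFinEquiv.symm p).1) y)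
  have hP : ∀ x y, P.accept x y = if f x y then 1 else 0 := by
    intro x y
    simp only [P, QProtocol.accept, QProtocol.acceptFrom, dotProduct, Fintype.sum_prod_type]
    rw [Fin.sum_univ_one, ← finProdFinEquiv.sum_comp, Fintype.sum_prod_type]
    rw [Finset.sum_eq_single (bitsEquiv n x)]
    · rw [Fin.sum_univ_one, ← Matrix.diagonal_one, Matrix.diagonal_kronecker_diagonal,
        Matrix.mulVec_diagonal]
      by_cases h : f x y <;>
        simp [h, aliceStep, V, Matrix.mulVec, dotProduct, Fintype.sum_prod_type]
    · intro b _ hb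
      simp [hb, aliceStep, V, Matrix.mulVec, dotProduct, Fintype.sum_prod_type]
    · simp
  refine ⟨⟨Unit, MeasureTheory.Measure.dirac (), fun _ => P, fun _ _ => measurable_const, n,
    fun _ => by simp [P, QProtocol.cost]⟩, rfl, fun x y => ?_⟩
  simp only [SharedRandomnessProtocol.accept, hP, MeasureTheory.integral_dirac]
  constructor <;> intro h <;> norm_num [h]

end

/-! After `c` qubits of communication the joint state is a sum of `2 ^ c` product vectors `A i ⊗ B
i`, one per message string, with `A` depending only on `x` and `B` only on `y`. The acceptance
probability is a squared norm, hence the entrywise pairing of the two Gram matrices: an inner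
product in dimension `4 ^ c`. Tracking norms (`QProtocol.acceptFrom_productSum`) shows that both
vectors lie in the unit ball once `2 ^ c` is factored out. By Hoeffding and a union bound over the
`4 ^ n` input pairs, `T = O(n * 4 ^ c)` samples replace the shared randomness. Concatenating the
sampled vectors with weight `1 / √T` averages their inner products, in dimension `O(n * 16 ^ c)`,
that is, `O(c + log n)` qubits. The fingerprints have inner product `p / 2 ^ c` with `p` close to
the acceptance probability, so the swap tests must resolve a gap of order `4 ^ (-c)` in `p ^ 2 / 4 ^
c`. Chebyshev asks for `r = O(16 ^ c / ε)` repetitions, and `c ≤ 16 ^ c` turns the total into `2 ^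
(8 * c) * log n`. For the SMP bound, the swap tests are realised as one effect on the two messages.
-/

noncomputable section

/-! ### Effects, and operators acting on one tensor factor. -/

-- Positivity of `1 - E` makes `S` a contraction, so a final measurement can be absorbed into one
-- party's vectors without increasing their norms.
open scoped MatrixOrder Matrix.Norms.L2Operator in
theorem IsEffect.exists_factor {ι : Type} [Fintype ι] [DecidableEq ι] {E : Matrix ι ι ℂ}
    (hE : IsEffect E) : ∃ S : Matrix ι ι ℂ, E = Sᴴ * S ∧
      ∀ w : ι → ℂ, ∑ p, ‖(S *ᵥ w) p‖ ^ 2 ≤ ∑ p, ‖w p‖ ^ 2 := by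
  have key : ∀ w : ι → ℂ, star w ⬝ᵥ w = ((∑ p, ‖w p‖ ^ 2 : ℝ) : ℂ) := fun w => by
    simp [dotProduct, Complex.conj_mul']
  obtain ⟨S, hS⟩ := CStarAlgebra.nonneg_iff_eq_star_mul_self.mp hE.1.nonneg
  rw [Matrix.star_eq_conjTranspose] at hS
  refine ⟨S, hS, fun w => ?_⟩
  have h := hE.2.dotProduct_mulVec_nonneg w
  rw [Matrix.sub_mulVec, Matrix.one_mulVec, dotProduct_sub, hS, ← Matrix.mulVec_mulVec,
    Matrix.dotProduct_mulVec, ← Matrix.star_mulVec, key, key, ← Complex.ofReal_sub,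
    Complex.zero_le_real] at h
  linarith

theorem re_dotProduct_conjTranspose_mul_self {ι : Type} [Fintype ι] (M : Matrix ι ι ℂ)
    (w : ι → ℂ) : (star w ⬝ᵥ ((Mᴴ * M) *ᵥ w)).re = ∑ p, ‖(M *ᵥ w) p‖ ^ 2 := by
  rw [← Matrix.mulVec_mulVec, Matrix.dotProduct_mulVec, ← Matrix.star_mulVec]
  have : star (M *ᵥ w) ⬝ᵥ (M *ᵥ w) = ((∑ p, ‖(M *ᵥ w) p‖ ^ 2 : ℝ) : ℂ) := by
    simp [dotProduct, Complex.conj_mul']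
  rw [this, Complex.ofReal_re]

theorem kronecker_one_mulVec {a b : ℕ} {m : Type} (S : Matrix m (Fin a) ℂ)
    (ψ : Fin a × Fin b → ℂ) (p : m) (q : Fin b) :
    ((S ⊗ₖ (1 : Matrix (Fin b) (Fin b) ℂ)) *ᵥ ψ) (p, q) = ∑ i, S p i * ψ (i, q) := by
  simp [Matrix.mulVec, dotProduct, Fintype.sum_prod_type, Matrix.one_apply]

theorem one_kronecker_mulVec {a b : ℕ} {m : Type} (S : Matrix m (Fin b) ℂ)
    (ψ : Fin a × Fin b → ℂ) (p : Fin a) (q : m) :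
    (((1 : Matrix (Fin a) (Fin a) ℂ) ⊗ₖ S) *ᵥ ψ) (p, q) = ∑ j, S q j * ψ (p, j) := by
  simp [Matrix.mulVec, dotProduct, Fintype.sum_prod_type, Matrix.one_apply]

/-! ### Product-sum states and the factorization of acceptance probabilities. -/

/-- The Gram matrix of a finite family of vectors. -/
def gramEntry {ι : Type} {a : ℕ} (A : ι → Fin a → ℂ) (k : ι × ι) : ℂ :=
  ∑ p, star (A k.1 p) * A k.2 p

/-- Cauchy–Schwarz on each entry; the double sum of the bounds is a perfect square. -/
theorem sum_norm_gramEntry_sq_le {ι : Type} [Fintype ι] {a : ℕ} (A : ι → Fin a → ℂ) {K : ℝ}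
    (hK : ∑ i, ∑ p, ‖A i p‖ ^ 2 ≤ K) : ∑ k, ‖gramEntry A k‖ ^ 2 ≤ K ^ 2 := by
  have h0 : 0 ≤ ∑ i, ∑ p, ‖A i p‖ ^ 2 := by positivity
  calc ∑ k, ‖gramEntry A k‖ ^ 2
      ≤ ∑ k : ι × ι, (∑ p, ‖A k.1 p‖ ^ 2) * (∑ p, ‖A k.2 p‖ ^ 2) := by
        refine Finset.sum_le_sum fun k _ => ?_
        refine le_trans ?_ (Finset.sum_mul_sq_le_sq_mul_sq _ _ _)
        gcongr
        refine (norm_sum_le _ _).trans (le_of_eq ?_)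
        simp
    _ = (∑ i, ∑ p, ‖A i p‖ ^ 2) ^ 2 := by
        rw [Fintype.sum_prod_type, sq, Finset.sum_mul_sum]
    _ ≤ K ^ 2 := by gcongr

/-- Expanding the square leaves inner products of product vectors, and these factor across the two
parties. -/
theorem sum_norm_sq_eq_sum_gramEntry {ι : Type} [Fintype ι] {a b : ℕ} (A : ι → Fin a → ℂ)
    (B : ι → Fin b → ℂ) :
    ((∑ p : Fin a × Fin b, ‖∑ i, A i p.1 * B i p.2‖ ^ 2 : ℝ) : ℂ) =
      ∑ k, gramEntry A k * gramEntry B k := by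
  simp only [gramEntry, Finset.sum_mul_sum, Complex.ofReal_sum, Complex.ofReal_pow,
    ← Complex.conj_mul', map_sum, map_mul, Fintype.sum_prod_type]
  have h : ∀ p : Fin a, ∀ q : Fin b, ∀ i j : ι,
      (starRingEnd ℂ) (A i p) * (starRingEnd ℂ) (B i q) * (A j p * B j q) =
      star (A i p) * A j p * (star (B i q) * B j q) := fun p q i j => by
    simp only [RCLike.star_def]; ring
  simp only [h]
  calc _ = ∑ p, ∑ i, ∑ q, ∑ j, star (A i p) * A j p * (star (B i q) * B j q) :=
        Finset.sum_congr rfl fun p _ => Finset.sum_comm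
    _ = ∑ i, ∑ p, ∑ q, ∑ j, star (A i p) * A j p * (star (B i q) * B j q) := Finset.sum_comm
    _ = ∑ i, ∑ p, ∑ j, ∑ q, star (A i p) * A j p * (star (B i q) * B j q) :=
        Finset.sum_congr rfl fun i _ => Finset.sum_congr rfl fun p _ => Finset.sum_comm
    _ = _ := Finset.sum_congr rfl fun i _ => Finset.sum_comm

/-- Splitting the outcome of an isometry into blocks preserves the total squared norm. -/
theorem sum_norm_mulVec_sq_of_isometry {m : Type} [Fintype m] {a : ℕ} {V : Matrix m (Fin a) ℂ}
    (hV : Vᴴ * V = 1) (w : Fin a → ℂ) : ∑ p, ‖(V *ᵥ w) p‖ ^ 2 = ∑ p, ‖w p‖ ^ 2 := by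
  have key : ∀ {l : Type} [Fintype l] (w : l → ℂ),
      star w ⬝ᵥ w = ((∑ p, ‖w p‖ ^ 2 : ℝ) : ℂ) := fun w => by
    simp [dotProduct, Complex.conj_mul']
  have : star (V *ᵥ w) ⬝ᵥ (V *ᵥ w) = star w ⬝ᵥ w := by
    rw [Matrix.star_mulVec, ← Matrix.dotProduct_mulVec, Matrix.mulVec_mulVec, hV,
      Matrix.one_mulVec]
  rw [key, key] at this
  exact_mod_cast this

/-- The state `∑ i, A i ⊗ B i`. -/
def productSum {ι : Type} [Fintype ι] {a b : ℕ} (A : ι → Fin a → ℂ)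
    (B : ι → Fin b → ℂ) (p : Fin a × Fin b) : ℂ :=
  ∑ i, A i p.1 * B i p.2

/-- The message value `m` becomes part of the summation index: Alice keeps block `m` of `V *ᵥ A i`,
and Bob's vector is tensored with the basis vector of `m`. -/
theorem aliceStep_productSum {ι : Type} [Fintype ι] {a b a' k : ℕ}
    (V : Matrix (Fin a' × Fin (2 ^ k)) (Fin a) ℂ) (A : ι → Fin a → ℂ) (B : ι → Fin b → ℂ) :
    aliceStep V (productSum A B) =
      productSum (fun (i : ι × Fin (2 ^ k)) p => (V *ᵥ A i.1) (p, i.2))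
        (fun i q => if i.2 = (finProdFinEquiv.symm q).1
          then B i.1 (finProdFinEquiv.symm q).2 else 0) := by
  ext ⟨p, q⟩
  simp only [aliceStep, productSum, Fintype.sum_prod_type, mul_ite, mul_zero]
  rw [kronecker_one_mulVec]
  simp only [productSum, Finset.sum_ite_eq', Finset.mem_univ, if_true, Matrix.mulVec,
    dotProduct, Finset.mul_sum, Finset.sum_mul, ← mul_assoc]
  rw [Finset.sum_comm]

theorem bobStep_productSum {ι : Type} [Fintype ι] {a b b' k : ℕ}
    (V : Matrix (Fin (2 ^ k) × Fin b') (Fin b) ℂ) (A : ι → Fin a → ℂ) (B : ι → Fin b → ℂ) :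
    bobStep V (productSum A B) =
      productSum (fun (i : ι × Fin (2 ^ k)) q => if i.2 = (finProdFinEquiv.symm q).2
          then A i.1 (finProdFinEquiv.symm q).1 else 0)
        (fun i p => (V *ᵥ B i.1) (i.2, p)) := by
  ext ⟨p, q⟩
  simp only [bobStep, productSum, Fintype.sum_prod_type, ite_mul, zero_mul]
  rw [one_kronecker_mulVec]
  simp only [productSum, Finset.sum_ite_eq', Finset.mem_univ, if_true, Matrix.mulVec,
    dotProduct, Finset.mul_sum]
  rw [Finset.sum_comm]
  refine Finset.sum_congr rfl fun _ _ => Finset.sum_congr rfl fun _ _ => by ring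

theorem QProtocol.acceptFrom_nonneg {X Y : Type} (x : X) (y : Y) {a b : ℕ}
    (P : QProtocol X Y a b) (ψ : Fin a × Fin b → ℂ) : 0 ≤ P.acceptFrom x y ψ := by
  induction P with
  | aliceOutput E hE =>
    exact (Complex.nonneg_iff.mp
      (((hE x).1.kronecker Matrix.PosSemidef.one).dotProduct_mulVec_nonneg ψ)).1
  | bobOutput E hE =>
    exact (Complex.nonneg_iff.mp
      ((Matrix.PosSemidef.one.kronecker (hE y).1).dotProduct_mulVec_nonneg ψ)).1
  | aliceSend _ _ V _ _ ih => exact ih _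
  | bobSend _ _ V _ _ ih => exact ih _

/-- Induction on the protocol, with an arbitrary product-sum as start. When `k` qubits are sent, the
sender's total squared norm is unchanged, because the isometry is only cut into blocks, while the
receiver's is multiplied by `2 ^ k`, one copy per message value. How the growth splits between the
parties depends on the protocol; only the product `K' * L'` is determined. -/
theorem QProtocol.acceptFrom_productSum {X Y : Type} {a b : ℕ} (P : QProtocol X Y a b) :
    ∀ {ι : Type} [Fintype ι] (A : X → ι → Fin a → ℂ) (B : Y → ι → Fin b → ℂ) (K L : ℝ),
      0 < K → 0 < L → (∀ x, ∑ i, ∑ p, ‖A x i p‖ ^ 2 ≤ K) → (∀ y, ∑ i, ∑ p, ‖B y i p‖ ^ 2 ≤ L) →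
      ∃ (κ : Type) (_ : Fintype κ) (u : X → κ → ℂ) (v : Y → κ → ℂ) (K' L' : ℝ),
        Fintype.card κ = (Fintype.card ι * 2 ^ P.cost) ^ 2 ∧ 0 < K' ∧ 0 < L' ∧
        K' * L' = K * L * 2 ^ P.cost ∧
        (∀ x, ∑ k, ‖u x k‖ ^ 2 ≤ K' ^ 2) ∧ (∀ y, ∑ k, ‖v y k‖ ^ 2 ≤ L' ^ 2) ∧
        ∀ x y, (P.acceptFrom x y (productSum (A x) (B y)) : ℂ) = ∑ k, u x k * v y k := by
  induction P with
  | @aliceOutput a b E hE =>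
    intro ι _ A B K L hK hL hA hB
    choose S hS hS' using fun x => (hE x).exists_factor
    refine ⟨ι × ι, inferInstance, fun x => gramEntry fun i => S x *ᵥ A x i,
      fun y => gramEntry (B y), K, L, by simp [QProtocol.cost, sq], hK, hL,
      by simp [QProtocol.cost],
      fun x => sum_norm_gramEntry_sq_le _
        ((Finset.sum_le_sum fun i _ => hS' x _).trans (hA x)),
      fun y => sum_norm_gramEntry_sq_le _ (hB y), fun x y => ?_⟩
    rw [← sum_norm_sq_eq_sum_gramEntry]
    have : E x ⊗ₖ (1 : Matrix (Fin b) (Fin b) ℂ) = (S x ⊗ₖ 1)ᴴ * (S x ⊗ₖ 1) := by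
      rw [Matrix.conjTranspose_kronecker, ← Matrix.mul_kronecker_mul, ← hS]; simp
    rw [QProtocol.acceptFrom, this, re_dotProduct_conjTranspose_mul_self]
    congr 1
    refine Finset.sum_congr rfl fun p _ => ?_
    rw [kronecker_one_mulVec]
    simp only [productSum, Matrix.mulVec, dotProduct, Finset.mul_sum, Finset.sum_mul, ← mul_assoc]
    rw [Finset.sum_comm]
  | @bobOutput a b E hE =>
    intro ι _ A B K L hK hL hA hB
    choose S hS hS' using fun y => (hE y).exists_factor
    refine ⟨ι × ι, inferInstance, fun x => gramEntry (A x),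
      fun y => gramEntry fun i => S y *ᵥ B y i, K, L, by simp [QProtocol.cost, sq], hK, hL,
      by simp [QProtocol.cost],
      fun x => sum_norm_gramEntry_sq_le _ (hA x),
      fun y => sum_norm_gramEntry_sq_le _
        ((Finset.sum_le_sum fun i _ => hS' y _).trans (hB y)), fun x y => ?_⟩
    rw [← sum_norm_sq_eq_sum_gramEntry]
    have : (1 : Matrix (Fin a) (Fin a) ℂ) ⊗ₖ E y = (1 ⊗ₖ S y)ᴴ * (1 ⊗ₖ S y) := by
      rw [Matrix.conjTranspose_kronecker, ← Matrix.mul_kronecker_mul, ← hS]; simp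
    rw [QProtocol.acceptFrom, this, re_dotProduct_conjTranspose_mul_self]
    congr 1
    refine Finset.sum_congr rfl fun p _ => ?_
    rw [one_kronecker_mulVec]
    simp only [productSum, Matrix.mulVec, dotProduct, Finset.mul_sum]
    rw [Finset.sum_comm]
    congr 2
    refine Finset.sum_congr rfl fun _ _ => Finset.sum_congr rfl fun _ _ => by ring
  | @aliceSend a b a' k V hV next ih =>
    intro ι _ A B K L hK hL hA hB
    obtain ⟨κ, hκ, u, v, K', L', hc, hK', hL', hKL, hu, hv, h⟩ := ih
      (fun x (i : ι × Fin (2 ^ k)) p => (V x *ᵥ A x i.1) (p, i.2))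
      (fun y i q => if i.2 = (finProdFinEquiv.symm q).1
          then B y i.1 (finProdFinEquiv.symm q).2 else 0) K (L * 2 ^ k) hK (by positivity)
      (fun x => by
        refine le_trans (le_of_eq ?_) (hA x)
        rw [Fintype.sum_prod_type]
        refine Finset.sum_congr rfl fun i _ => ?_
        rw [← sum_norm_mulVec_sq_of_isometry (hV x), Fintype.sum_prod_type, Finset.sum_comm])
      (fun y => by
        have : ∀ i : ι, ∀ m : Fin (2 ^ k), (∑ q : Fin (2 ^ k * b), ‖if m =
            (finProdFinEquiv.symm q).1 then B y i (finProdFinEquiv.symm q).2 else 0‖ ^ 2) =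
            ∑ q, ‖B y i q‖ ^ 2 := fun i m => by
          rw [← finProdFinEquiv.sum_comp, Fintype.sum_prod_type, Finset.sum_eq_single m]
          · simp
          · intro m' _ hm; simp [hm.symm]
          · simp
        simp only [Fintype.sum_prod_type, this, Finset.sum_const, Finset.card_univ,
          Fintype.card_fin, nsmul_eq_mul, ← Finset.mul_sum]
        push_cast
        nlinarith [hB y, pow_pos (two_pos (α := ℝ)) k])
    refine ⟨κ, hκ, u, v, K', L', ?_, hK', hL', ?_, hu, hv, fun x y => ?_⟩
    · rw [hc]; simp [QProtocol.cost, pow_add, mul_assoc]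
    · rw [hKL, QProtocol.cost, pow_add]; ring
    · rw [← h, QProtocol.acceptFrom, aliceStep_productSum]
  | @bobSend a b b' k V hV next ih =>
    intro ι _ A B K L hK hL hA hB
    obtain ⟨κ, hκ, u, v, K', L', hc, hK', hL', hKL, hu, hv, h⟩ := ih
      (fun x (i : ι × Fin (2 ^ k)) q => if i.2 = (finProdFinEquiv.symm q).2
          then A x i.1 (finProdFinEquiv.symm q).1 else 0)
      (fun y i p => (V y *ᵥ B y i.1) (i.2, p)) (K * 2 ^ k) L (by positivity) hL
      (fun x => by
        have : ∀ i : ι, ∀ m : Fin (2 ^ k), (∑ q : Fin (a * 2 ^ k), ‖if m =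
            (finProdFinEquiv.symm q).2 then A x i (finProdFinEquiv.symm q).1 else 0‖ ^ 2) =
            ∑ q, ‖A x i q‖ ^ 2 := fun i m => by
          rw [← finProdFinEquiv.sum_comp, Fintype.sum_prod_type]
          refine Finset.sum_congr rfl fun p _ => ?_
          rw [Finset.sum_eq_single m]
          · simp
          · intro m' _ hm; simp [hm.symm]
          · simp
        simp only [Fintype.sum_prod_type, this, Finset.sum_const, Finset.card_univ,
          Fintype.card_fin, nsmul_eq_mul, ← Finset.mul_sum]
        push_cast
        nlinarith [hA x, pow_pos (two_pos (α := ℝ)) k])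
      (fun y => by
        refine le_trans (le_of_eq ?_) (hB y)
        rw [Fintype.sum_prod_type]
        refine Finset.sum_congr rfl fun i _ => ?_
        rw [← sum_norm_mulVec_sq_of_isometry (hV y), Fintype.sum_prod_type])
    refine ⟨κ, hκ, u, v, K', L', ?_, hK', hL', ?_, hu, hv, fun x y => ?_⟩
    · rw [hc]; simp [QProtocol.cost, pow_add, mul_assoc]
    · rw [hKL, QProtocol.cost, pow_add]; ring
    · rw [← h, QProtocol.acceptFrom, bobStep_productSum]

/-- The acceptance probabilities of a `c`-qubit protocol form, up to the factor `2 ^ c`, a matrix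
of inner products of vectors of norm at most one in dimension at most `4 ^ c`. -/
theorem QProtocol.accept_factorization {X Y : Type} (P : QProtocol X Y 1 1) {c : ℕ}
    (hc : P.cost ≤ c) : ∃ (κ : Type) (_ : Fintype κ) (u : X → κ → ℂ) (v : Y → κ → ℂ),
      Fintype.card κ ≤ 4 ^ c ∧ (∀ x, ∑ k, ‖u x k‖ ^ 2 ≤ 1) ∧ (∀ y, ∑ k, ‖v y k‖ ^ 2 ≤ 1) ∧
      ∀ x y, (P.accept x y : ℂ) = 2 ^ c * ∑ k, u x k * v y k := by
  obtain ⟨κ, hκ, u, v, K, L, hcard, hK, hL, hKL, hu, hv, h⟩ := P.acceptFrom_productSum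
    (ι := Unit) (fun _ _ _ => 1) (fun _ _ _ => 1) 1 1 one_pos one_pos (by simp) (by simp)
  -- Dividing by `K` and `L` normalises the vectors; this further factor, at most one, goes into `u`
  -- when the actual cost is below `c`.
  have hs : (0 : ℝ) < 2 ^ P.cost / 2 ^ c := by positivity
  have hs1 : (2 : ℝ) ^ P.cost / 2 ^ c ≤ 1 := by
    rw [div_le_one (by positivity)]; exact pow_le_pow_right₀ (by norm_num) hc
  refine ⟨κ, hκ, fun x k => ((2 ^ P.cost / 2 ^ c : ℝ) / K : ℝ) * u x k,
    fun y k => (1 / L : ℝ) * v y k, ?_, fun x => ?_, fun y => ?_, fun x y => ?_⟩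
  · rw [hcard, Fintype.card_unit, one_mul, ← pow_mul, mul_comm, pow_mul]
    exact Nat.pow_le_pow_right (by norm_num) hc
  · simp only [norm_mul, mul_pow, ← Finset.mul_sum, Complex.norm_real, Real.norm_eq_abs, sq_abs]
    rw [div_pow, div_mul_eq_mul_div, div_le_one (by positivity)]
    calc _ ≤ 1 * ∑ k, ‖u x k‖ ^ 2 := by
          gcongr; exact pow_le_one₀ hs.le hs1
      _ ≤ K ^ 2 := by rw [one_mul]; exact hu x
  · simp only [norm_mul, mul_pow, ← Finset.mul_sum, Complex.norm_real, Real.norm_eq_abs, sq_abs]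
    rw [div_pow, div_mul_eq_mul_div, div_le_one (by positivity), one_pow, one_mul]
    exact hv y
  · have h1 : P.accept x y = P.acceptFrom x y
        (productSum (fun (_ : Unit) (_ : Fin 1) => (1 : ℂ)) fun _ _ => 1) := by
      rw [QProtocol.accept]; congr 1; ext; simp [productSum]
    rw [h1, h x y]
    have hKL' : (K : ℂ) * L = 2 ^ P.cost := by
      have : K * L = 2 ^ P.cost := by rw [hKL]; ring
      exact_mod_cast this
    have hK0 : (K : ℂ) ≠ 0 := by exact_mod_cast hK.ne'
    have hL0 : (L : ℂ) ≠ 0 := by exact_mod_cast hL.ne'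
    rw [Finset.mul_sum]
    refine Finset.sum_congr rfl fun k _ => ?_
    push_cast
    rw [← hKL']
    field_simp

/-! ### Replacing shared randomness by finitely many samples. -/

/-- Finitely many bounded expectations are approximated simultaneously by one empirical mean. -/
theorem exists_sample_mean_near_integral {R ι : Type} [MeasurableSpace R] [Fintype ι]
    (μ : MeasureTheory.Measure R) [MeasureTheory.IsProbabilityMeasure μ] (p : ι → R → ℝ)
    (hm : ∀ i, Measurable (p i)) {N δ : ℝ} (hN : 0 < N) (hδ : 0 < δ)
    (hp : ∀ i r, p i r ∈ Set.Icc 0 N) {T : ℕ} (hT : 0 < T)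
    (h : Fintype.card ι * (2 * Real.exp (-(2 * T * δ ^ 2 / N ^ 2))) < 1) :
    ∃ s : Fin T → R, ∀ i, |(∑ t, p i (s t)) / T - ∫ r, p i r ∂μ| < δ := by
  have hT' : (0 : ℝ) < T := by exact_mod_cast hT
  let ν := MeasureTheory.Measure.pi fun _ : Fin T => μ
  -- The left endpoint `a` is free so that the same upper tail bound serves for `p i` and for `-p
  -- i`.
  have tail : ∀ g : R → ℝ, Measurable g → ∀ a : ℝ, (∀ r, g r ∈ Set.Icc a (a + N)) →
      ν.real {s | T * δ ≤ ∑ t, (g (s t) - ∫ r, g r ∂μ)} ≤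
        Real.exp (-(2 * T * δ ^ 2 / N ^ 2)) := fun g hg a hga => by
    have hind : ProbabilityTheory.iIndepFun
        (fun (t : Fin T) s => g (s t) - ∫ r, g r ∂μ) ν :=
      ProbabilityTheory.iIndepFun_pi (X := fun _ r => g r - ∫ r, g r ∂μ)
        fun _ => (hg.sub_const _).aemeasurable
    have hsub : ∀ t : Fin T, ProbabilityTheory.HasSubgaussianMGF
        (fun s => g (s t) - ∫ r, g r ∂μ) ((‖a + N - a‖₊ / 2) ^ 2) ν := fun t => by
      have := ProbabilityTheory.hasSubgaussianMGF_of_mem_Icc (μ := ν) (X := fun s => g (s t))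
        (hg.comp (measurable_pi_apply t)).aemeasurable (.of_forall fun s => hga (s t))
      rwa [MeasureTheory.integral_comp_eval hg.aestronglyMeasurable] at this
    refine (ProbabilityTheory.HasSubgaussianMGF.measure_sum_ge_le_of_iIndepFun hind
      (s := Finset.univ) (fun t _ => hsub t) (by positivity)).trans (le_of_eq ?_)
    congr 1
    simp [abs_of_pos hN]
    field_simp
  let bad : ι × Bool → Set (Fin T → R) := fun i =>
    if i.2 then {s | T * δ ≤ ∑ t, (p i.1 (s t) - ∫ r, p i.1 r ∂μ)}
    else {s | T * δ ≤ ∑ t, (-p i.1 (s t) - ∫ r, -p i.1 r ∂μ)}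
  have hbad : ∀ i, ν.real (bad i) ≤ Real.exp (-(2 * T * δ ^ 2 / N ^ 2)) := fun i => by
    by_cases hi : i.2
    · simp only [bad, hi, if_true]
      exact tail _ (hm i.1) 0 fun r => by simpa using hp i.1 r
    · simp only [bad, hi]
      exact tail (fun r => -p i.1 r) (hm i.1).neg (-N) fun r => by
        have := hp i.1 r
        constructor <;> linarith [this.1, this.2]
  have hU : ν.real (⋃ i, bad i) < 1 := by
    refine lt_of_le_of_lt ((MeasureTheory.measureReal_iUnion_fintype_le _).trans
      (Finset.sum_le_sum fun i _ => hbad i)) ?_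
    simp only [Finset.sum_const, Finset.card_univ, Fintype.card_prod, Fintype.card_bool,
      nsmul_eq_mul]
    push_cast
    linarith
  obtain ⟨s, hs⟩ : ∃ s, s ∉ ⋃ i, bad i := by
    by_contra! hall
    rw [Set.eq_univ_of_forall hall, MeasureTheory.probReal_univ] at hU
    exact lt_irrefl _ hU
  simp only [Set.mem_iUnion, not_exists] at hs
  refine ⟨s, fun i => ?_⟩
  have h1 := hs (i, true)
  have h2 := hs (i, false)
  simp only [bad, if_true, Bool.false_eq_true, if_false, Set.mem_ofPred_eq, not_le,
    Finset.sum_sub_distrib, Finset.sum_neg_distrib, Finset.sum_const, Finset.card_univ,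
    Fintype.card_fin, nsmul_eq_mul, MeasureTheory.integral_neg] at h1 h2
  have e : (∑ t, p i (s t)) / T - ∫ r, p i r ∂μ =
      (∑ t, p i (s t) - T * ∫ r, p i r ∂μ) / T := by field_simp
  rw [e, abs_lt, lt_div_iff₀ hT', div_lt_iff₀ hT']
  constructor <;> linarith

/-! ### Completing and averaging fingerprint vectors. -/

/-- Vectors of norm at most one can be completed to unit vectors with the same inner products,
using two additional dimensions. -/
theorem exists_unit_vectors {X Y κ : Type} [Fintype κ] (u : X → κ → ℂ) (v : Y → κ → ℂ)
    (hu : ∀ x, ∑ k, ‖u x k‖ ^ 2 ≤ 1) (hv : ∀ y, ∑ k, ‖v y k‖ ^ 2 ≤ 1) {D : ℕ}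
    (hD : Fintype.card κ + 2 ≤ D) :
    ∃ (α : X → EuclideanSpace ℂ (Fin D)) (β : Y → EuclideanSpace ℂ (Fin D)),
      (∀ x, ‖α x‖ = 1) ∧ (∀ y, ‖β y‖ = 1) ∧
      ∀ x y, inner ℂ (α x) (β y) = ∑ k, u x k * v y k := by
  -- The two `Bool` coordinates hold the missing norm, `true` for Alice and `false` for Bob, so they
  -- contribute nothing to the inner product; the last summand is zero padding.
  let e : Fin D ≃ κ ⊕ Bool ⊕ Fin (D - (Fintype.card κ + 2)) :=
    (Fintype.equivFinOfCardEq (by simp; omega)).symm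
  have unit : ∀ (z : Bool) (w : κ → ℂ), ∑ k, ‖w k‖ ^ 2 ≤ 1 →
      ‖(WithLp.toLp 2 fun i => Sum.elim w (Sum.elim
        (fun b => if b = z then (√(1 - ∑ k, ‖w k‖ ^ 2) : ℂ) else 0) 0) (e i) :
        EuclideanSpace ℂ (Fin D))‖ = 1 := fun z w hw => by
    rw [EuclideanSpace.norm_eq, Real.sqrt_eq_one]
    simp only
    rw [e.sum_comp fun i => ‖Sum.elim w (Sum.elim
        (fun b => if b = z then (√(1 - ∑ k, ‖w k‖ ^ 2) : ℂ) else 0) 0) i‖ ^ 2]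
    have : 0 ≤ 1 - ∑ k, ‖w k‖ ^ 2 := by linarith
    cases z <;> simp [Real.sq_sqrt this]
  -- The conjugate cancels the conjugation in the first argument of `inner`.
  refine ⟨fun x => .toLp 2 fun i => Sum.elim (star (u x)) (Sum.elim (fun b => if b = true then
      (√(1 - ∑ k, ‖star (u x) k‖ ^ 2) : ℂ) else 0) 0) (e i),
    fun y => .toLp 2 fun i => Sum.elim (v y) (Sum.elim (fun b => if b = false then
      (√(1 - ∑ k, ‖v y k‖ ^ 2) : ℂ) else 0) 0) (e i),
    fun x => unit true (star (u x)) (by simpa using hu x), fun y => unit false (v y) (hv y),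
    fun x y => ?_⟩
  rw [PiLp.inner_apply]
  simp only
  rw [e.sum_comp fun i => inner ℂ (Sum.elim (star (u x)) (Sum.elim (fun b => if b = true then
      (√(1 - ∑ k, ‖star (u x) k‖ ^ 2) : ℂ) else 0) 0) i) (Sum.elim (v y) (Sum.elim
      (fun b => if b = false then (√(1 - ∑ k, ‖v y k‖ ^ 2) : ℂ) else 0) 0) i)]
  simp [mul_comm]

theorem sum_norm_inv_sqrt_mul_sq_le {T : ℕ} (hT : (0 : ℝ) < T) {κ : Fin T → Type}
    [∀ t, Fintype (κ t)] (w : (t : Fin T) → κ t → ℂ) (hw : ∀ t, ∑ k, ‖w t k‖ ^ 2 ≤ 1) :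
    ∑ k : Σ t, κ t, ‖(((√(T : ℝ))⁻¹ : ℝ) : ℂ) * w k.1 k.2‖ ^ 2 ≤ 1 := by
  rw [Fintype.sum_sigma]
  simp only [norm_mul, mul_pow, ← Finset.mul_sum, Complex.norm_real,
    Real.norm_eq_abs, sq_abs, inv_pow, Real.sq_sqrt hT.le]
  rw [inv_mul_le_iff₀ hT, mul_one]
  refine (Finset.sum_le_sum fun t _ => hw t).trans ?_
  simp

theorem sum_inv_sqrt_mul_mul {T : ℕ} (hT : (0 : ℝ) < T) {κ : Fin T → Type}
    [∀ t, Fintype (κ t)] (u v : (t : Fin T) → κ t → ℂ) :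
    ∑ k : Σ t, κ t, (((√(T : ℝ))⁻¹ : ℝ) : ℂ) * u k.1 k.2 *
      ((((√(T : ℝ))⁻¹ : ℝ) : ℂ) * v k.1 k.2) = (∑ t, ∑ k, u t k * v t k) / T := by
  have hs : (((√(T : ℝ))⁻¹ : ℝ) : ℂ) * ((√(T : ℝ))⁻¹ : ℝ) = (T : ℂ)⁻¹ := by
    rw [← Complex.ofReal_mul, ← mul_inv, Real.mul_self_sqrt hT.le]; simp
  rw [Fintype.sum_sigma, div_eq_inv_mul, Finset.mul_sum]
  refine Finset.sum_congr rfl fun t _ => ?_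
  rw [Finset.mul_sum]
  refine Finset.sum_congr rfl fun k _ => ?_
  rw [mul_mul_mul_comm, hs]

/-- Averages of inner products of vectors of norm at most one are again such inner products. -/
theorem exists_average_inner {X Y : Type} {T D : ℕ} (hT : (0 : ℝ) < T) (κ : Fin T → Type)
    [∀ t, Fintype (κ t)] (u : ∀ t, X → κ t → ℂ) (v : ∀ t, Y → κ t → ℂ)
    (hcard : ∀ t, Fintype.card (κ t) ≤ D) (hu : ∀ t x, ∑ k, ‖u t x k‖ ^ 2 ≤ 1)
    (hv : ∀ t y, ∑ k, ‖v t y k‖ ^ 2 ≤ 1) :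
    ∃ (κ' : Type) (_ : Fintype κ') (u' : X → κ' → ℂ) (v' : Y → κ' → ℂ),
      Fintype.card κ' ≤ T * D ∧ (∀ x, ∑ k, ‖u' x k‖ ^ 2 ≤ 1) ∧ (∀ y, ∑ k, ‖v' y k‖ ^ 2 ≤ 1) ∧
      ∀ x y, ∑ k, u' x k * v' y k = (∑ t, ∑ k, u t x k * v t y k) / T := by
  refine ⟨Σ t, κ t, inferInstance, fun x k => (((√(T : ℝ))⁻¹ : ℝ) : ℂ) * u k.1 x k.2,
    fun y k => (((√(T : ℝ))⁻¹ : ℝ) : ℂ) * v k.1 y k.2, ?_,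
    fun x => sum_norm_inv_sqrt_mul_sq_le hT (fun t => u t x) fun t => hu t x,
    fun y => sum_norm_inv_sqrt_mul_sq_le hT (fun t => v t y) fun t => hv t y,
    fun x y => sum_inv_sqrt_mul_mul hT (fun t => u t x) fun t => v t y⟩
  rw [Fintype.card_sigma]
  refine (Finset.sum_le_sum fun t _ => hcard t).trans ?_
  simp

/-- Averaging the factorizations of `T` protocols. -/
theorem exists_average_factorization {X Y : Type} {T c : ℕ} (hT : 0 < T)
    (P : Fin T → QProtocol X Y 1 1) (hc : ∀ t, (P t).cost ≤ c) :
    ∃ (κ : Type) (_ : Fintype κ) (u : X → κ → ℂ) (v : Y → κ → ℂ),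
      Fintype.card κ ≤ T * 4 ^ c ∧ (∀ x, ∑ k, ‖u x k‖ ^ 2 ≤ 1) ∧ (∀ y, ∑ k, ‖v y k‖ ^ 2 ≤ 1) ∧
      ∀ x y, ∑ k, u x k * v y k = (((∑ t, (P t).accept x y) / T / 2 ^ c : ℝ) : ℂ) := by
  choose κ hκ u v hcard hu hv h using fun t => (P t).accept_factorization (hc t)
  obtain ⟨κ', hκ', u', v', hcard', hu', hv', h'⟩ :=
    exists_average_inner (by exact_mod_cast hT) κ u v hcard hu hv
  refine ⟨κ', hκ', u', v', hcard', hu', hv', fun x y => ?_⟩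
  have h2 : (2 : ℂ) ^ c ≠ 0 := by positivity
  rw [h']
  push_cast
  simp only [h, ← Finset.mul_sum]
  field_simp

/-- Cauchy–Schwarz on the factorization. The bound `2 ^ c` in place of `1` costs only a factor `4 ^
c` in the number of samples, hence `2 * c` qubits per fingerprint. -/
theorem QProtocol.accept_mem_Icc {X Y : Type} (P : QProtocol X Y 1 1) {c : ℕ} (hc : P.cost ≤ c)
    (x : X) (y : Y) : P.accept x y ∈ Set.Icc (0 : ℝ) (2 ^ c) := by
  refine ⟨P.acceptFrom_nonneg x y _, ?_⟩
  obtain ⟨κ, hκ, u, v, -, hu, hv, h⟩ := P.accept_factorization hc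
  obtain ⟨α, β, hα, hβ, hαβ⟩ := exists_unit_vectors u v hu hv le_rfl
  have h' := congrArg (‖·‖) (h x y)
  simp only [Complex.norm_real, Real.norm_eq_abs, norm_mul, norm_pow, Complex.norm_ofNat,
    ← hαβ] at h'
  refine (le_abs_self _).trans (h'.trans_le (mul_le_of_le_one_right (by positivity) ?_))
  refine (norm_inner_le_norm _ _).trans ?_
  rw [hα, hβ, one_mul]

/-! ### Chebyshev's inequality for the repeated swap test. -/

/-- Variances of independent centred variables add. The offset `t` drives the induction: the first
outcome is absorbed into it. -/
theorem sum_prod_mul_sq_add {r : ℕ} {w g : Bool → ℝ} {v : ℝ} (hw : ∑ b, w b = 1)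
    (hg : ∑ b, w b * g b = 0) (hv : ∑ b, w b * g b ^ 2 = v) (t : ℝ) :
    ∑ z : Fin r → Bool, (∏ i, w (z i)) * (t + ∑ i, g (z i)) ^ 2 = t ^ 2 + r * v := by
  induction r generalizing t with
  | zero => simp
  | succ r ih =>
    rw [← (Fin.consEquiv fun _ => Bool).sum_comp, Fintype.sum_prod_type]
    simp only [Fin.consEquiv_apply, Fin.prod_univ_succ, Fin.sum_univ_succ, Fin.cons_zero,
      Fin.cons_succ, ← add_assoc, mul_assoc, ← Finset.mul_sum, ih]
    simp only [Fintype.sum_bool] at hw hg hv ⊢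
    push_cast
    linear_combination (t ^ 2 + r * v) * hw + 2 * t * hg + hv

theorem sum_prod_eq_one {r : ℕ} {w : Bool → ℝ} (hw : ∑ b, w b = 1) :
    ∑ z : Fin r → Bool, ∏ i, w (z i) = 1 := by
  rw [← Fintype.piFinset_univ, Finset.sum_prod_piFinset Finset.univ fun _ => w]
  simp only [hw, Finset.prod_const_one]

namespace FingerprintProtocol
variable {X Y : Type} (F : FingerprintProtocol X Y)

theorem norm_inner_sq_le_one (x : X) (y : Y) : ‖inner ℂ (F.α x) (F.β y)‖ ^ 2 ≤ 1 := by
  refine pow_le_one₀ (norm_nonneg _) ((norm_inner_le_norm _ _).trans ?_)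
  rw [F.norm_α, F.norm_β, one_mul]

theorem swapTest_nonneg (x : X) (y : Y) (z : Bool) : 0 ≤ F.swapTest x y z := by
  have := F.norm_inner_sq_le_one x y
  unfold swapTest
  split_ifs
  · linarith
  · positivity

theorem sum_swapTest (x : X) (y : Y) : ∑ z, F.swapTest x y z = 1 := by
  simp only [swapTest, Fintype.sum_bool, if_true, Bool.false_eq_true, if_false]
  ring

/-- The estimate averages `r` independent signs of mean `m`, so its variance is `(1 - m ^ 2) / r`.
-/
theorem sum_estimate_sub_sq_le (x : X) (y : Y) (hr : 0 < F.r) :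
    ∑ z : Fin F.r → Bool, (∏ i, F.swapTest x y (z i)) *
      (F.estimate z - ‖inner ℂ (F.α x) (F.β y)‖ ^ 2) ^ 2 ≤ 1 / F.r := by
  set m := ‖inner ℂ (F.α x) (F.β y)‖ ^ 2 with hm
  have hr' : (0 : ℝ) < F.r := by exact_mod_cast hr
  have h := sum_prod_mul_sq_add (r := F.r) (w := F.swapTest x y)
    (g := fun b => (if b then (0 : ℝ) else 2) - 1 - m) (v := 1 - m ^ 2) (F.sum_swapTest x y)
    (by simp [swapTest, ← hm]; ring) (by simp [swapTest, ← hm]; ring) 0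
  have e : ∀ z : Fin F.r → Bool, F.estimate z - m =
      (∑ i, ((if z i then (0 : ℝ) else 2) - 1 - m)) / F.r := fun z => by
    have : ∑ i, (if z i then (0 : ℝ) else 2) =
        2 * ((Finset.univ.filter fun i => z i = false).card : ℝ) := by
      rw [Finset.card_filter]
      push_cast
      rw [Finset.mul_sum]
      refine Finset.sum_congr rfl fun i _ => ?_
      cases z i <;> simp
    rw [Finset.sum_sub_distrib, Finset.sum_sub_distrib, this, estimate]
    simp only [Finset.sum_const, Finset.card_univ, Fintype.card_fin, nsmul_eq_mul]
    field_simp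
  simp only [zero_add] at h
  simp only [e, div_pow, ← mul_div_assoc, ← Finset.sum_div]
  rw [h, div_le_div_iff₀ (by positivity) hr']
  nlinarith [mul_nonneg (sq_nonneg m) (sq_nonneg (F.r : ℝ))]

/-- Chebyshev: a threshold at distance at least `δ` from `|⟨α x, β y⟩|²` gives error at most
`1 / (r δ²)`. -/
theorem accept_le {x : X} {y : Y} {δ : ℝ} (hδ : 0 < δ) (hr : 0 < F.r)
    (h : ‖inner ℂ (F.α x) (F.β y)‖ ^ 2 + δ ≤ F.τ) : F.accept x y ≤ 1 / F.r / δ ^ 2 := by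
  rw [le_div_iff₀ (by positivity), accept, Finset.sum_mul]
  refine le_trans (Finset.sum_le_sum fun z _ => ?_) (F.sum_estimate_sub_sq_le x y hr)
  have hp : 0 ≤ ∏ i, F.swapTest x y (z i) :=
    Finset.prod_nonneg fun i _ => F.swapTest_nonneg x y _
  split_ifs with hz
  · refine mul_le_mul_of_nonneg_left (pow_le_pow_left₀ hδ.le ?_ 2) hp
    linarith
  · rw [zero_mul]; positivity

theorem le_accept {x : X} {y : Y} {δ : ℝ} (hδ : 0 < δ) (hr : 0 < F.r)
    (h : F.τ + δ ≤ ‖inner ℂ (F.α x) (F.β y)‖ ^ 2) : 1 - 1 / F.r / δ ^ 2 ≤ F.accept x y := by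
  have h1 := sum_prod_eq_one (r := F.r) (F.sum_swapTest x y)
  rw [sub_le_comm, le_div_iff₀ (by positivity), accept]
  -- With `1` written as the total probability, the difference is the probability of the rejecting
  -- outcomes.
  nth_rewrite 1 [← h1]
  rw [← Finset.sum_sub_distrib, Finset.sum_mul]
  refine le_trans (Finset.sum_le_sum fun z _ => ?_) (F.sum_estimate_sub_sq_le x y hr)
  have hp : 0 ≤ ∏ i, F.swapTest x y (z i) :=
    Finset.prod_nonneg fun i _ => F.swapTest_nonneg x y _
  split_ifs with hz
  · rw [sub_self, zero_mul]; positivity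
  · rw [sub_zero]
    refine mul_le_mul_of_nonneg_left ?_ hp
    rw [← neg_sq (F.estimate z - _)]
    exact pow_le_pow_left₀ hδ.le (by linarith) 2

end FingerprintProtocol

/-! ### Tensor powers of matrices. -/

section TensorFamily
variable {ι κ : Type} [Fintype ι]

/-- The tensor product of a finite family of matrices. -/
def tensorFamily (M : ι → Matrix κ κ ℂ) : Matrix (ι → κ) (ι → κ) ℂ :=
  Matrix.of fun u v => ∏ i, M i (u i) (v i)

theorem tensorFamily_mul [DecidableEq ι] [Fintype κ] (M N : ι → Matrix κ κ ℂ) :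
    tensorFamily M * tensorFamily N = tensorFamily fun i => M i * N i := by
  ext u v
  simp only [tensorFamily, Matrix.mul_apply, Matrix.of_apply, ← Finset.prod_mul_distrib]
  rw [Finset.prod_univ_sum, Fintype.piFinset_univ]

theorem tensorFamily_conjTranspose (M : ι → Matrix κ κ ℂ) :
    (tensorFamily M)ᴴ = tensorFamily fun i => (M i)ᴴ := by
  ext u v
  simp [tensorFamily, Matrix.conjTranspose_apply]

theorem tensorFamily_one [DecidableEq κ] :
    tensorFamily (fun _ : ι => (1 : Matrix κ κ ℂ)) = 1 := by
  ext u v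
  simp only [tensorFamily, Matrix.of_apply, Matrix.one_apply, funext_iff]
  rw [Finset.prod_ite_zero]
  simp

theorem trace_tensorFamily [DecidableEq ι] [Fintype κ] (M : ι → Matrix κ κ ℂ) :
    (tensorFamily M).trace = ∏ i, (M i).trace := by
  simp only [Matrix.trace, Matrix.diag, tensorFamily, Matrix.of_apply]
  rw [Finset.prod_univ_sum, Fintype.piFinset_univ]

theorem sum_tensorFamily [DecidableEq ι] {Z : Type} [Fintype Z] (M : Z → Matrix κ κ ℂ) :
    ∑ z : ι → Z, tensorFamily (fun i => M (z i)) = tensorFamily fun _ => ∑ z, M z := by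
  ext u v
  simp only [tensorFamily, Matrix.sum_apply, Matrix.of_apply]
  rw [Finset.prod_univ_sum, Fintype.piFinset_univ]

theorem tensorFamily_vecMulVec (a : κ → ℂ) :
    tensorFamily (fun _ : ι => Matrix.vecMulVec a (star a)) =
      Matrix.vecMulVec (fun u => ∏ i, a (u i)) (star fun u => ∏ i, a (u i)) := by
  ext u v
  simp [tensorFamily, Matrix.vecMulVec_apply, Finset.prod_mul_distrib]

/-- The tensor product of orthogonal projections is positive semidefinite. -/
theorem posSemidef_tensorFamily [DecidableEq ι] [Fintype κ] {M : ι → Matrix κ κ ℂ}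
    (hM : ∀ i, (M i)ᴴ * M i = M i) : (tensorFamily M).PosSemidef := by
  have := Matrix.posSemidef_conjTranspose_mul_self (tensorFamily M)
  rwa [tensorFamily_conjTranspose, tensorFamily_mul, funext hM] at this

end TensorFamily

/-! ### The swap test as a projective measurement. -/

/-- The operator exchanging two registers. -/
def swapMatrix (κ : Type) [DecidableEq κ] : Matrix (κ × κ) (κ × κ) ℂ :=
  Matrix.of fun p q => if p.swap = q then 1 else 0

theorem swapMatrix_mul_self {κ : Type} [Fintype κ] [DecidableEq κ] : swapMatrix κ * swapMatrix κ = 1 := by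
  ext p q
  simp only [swapMatrix, Matrix.mul_apply, Matrix.of_apply, ite_mul, one_mul, zero_mul,
    Finset.sum_ite_eq, Finset.mem_univ, if_true, Prod.swap_swap, Matrix.one_apply]

theorem conjTranspose_swapMatrix {κ : Type} [DecidableEq κ] : (swapMatrix κ)ᴴ = swapMatrix κ := by
  ext p q
  simp only [swapMatrix, Matrix.conjTranspose_apply, Matrix.of_apply]
  rw [apply_ite star, star_one, star_zero]
  refine if_congr ⟨fun h => ?_, fun h => ?_⟩ rfl rfl <;> rw [← h, Prod.swap_swap]

/-- The measurement projections of the swap test. -/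
def swapProjection (κ : Type) [DecidableEq κ] (z : Bool) :
    Matrix (κ × κ) (κ × κ) ℂ :=
  (1 / 2 : ℂ) • (1 + (if z then (-1 : ℂ) else 1) • swapMatrix κ)

theorem swapProjection_isProjection {κ : Type} [Fintype κ] [DecidableEq κ] (z : Bool) :
    (swapProjection κ z)ᴴ * swapProjection κ z = swapProjection κ z := by
  have h := swapMatrix_mul_self (κ := κ)
  cases z <;>
  · simp only [swapProjection, Matrix.conjTranspose_smul, Matrix.conjTranspose_add,
      conjTranspose_swapMatrix, Matrix.conjTranspose_one, smul_mul_smul_comm, add_mul, mul_add,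
      one_mul, mul_one, h]
    simp only [if_true, if_false, Bool.false_eq_true, star_div₀, star_one, star_ofNat, star_neg]
    module

theorem sum_swapProjection {κ : Type} [DecidableEq κ] : ∑ z, swapProjection κ z = 1 := by
  simp only [swapProjection, Fintype.sum_bool, if_true, Bool.false_eq_true, if_false]
  module

theorem trace_swapMatrix_mul {κ : Type} [Fintype κ] [DecidableEq κ] (a b : κ → ℂ) :
    (swapMatrix κ * (Matrix.vecMulVec a (star a) ⊗ₖ Matrix.vecMulVec b (star b))).trace =
      ((‖star a ⬝ᵥ b‖ ^ 2 : ℝ) : ℂ) := by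
  rw [Complex.ofReal_pow, ← Complex.mul_conj']
  simp only [Matrix.trace, Matrix.diag, Matrix.mul_apply, swapMatrix, Matrix.of_apply, ite_mul,
    one_mul, zero_mul, Finset.sum_ite_eq, Finset.mem_univ, if_true, Fintype.sum_prod_type,
    Prod.swap_prod_mk, Matrix.kroneckerMap_apply, Matrix.vecMulVec_apply, dotProduct, map_sum,
    Finset.sum_mul_sum]
  refine Finset.sum_congr rfl fun p _ => Finset.sum_congr rfl fun q _ => ?_
  simp
  ring

theorem trace_vecMulVec_kronecker {κ : Type} [Fintype κ] (a b : κ → ℂ) :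
    (Matrix.vecMulVec a (star a) ⊗ₖ Matrix.vecMulVec b (star b)).trace =
      ((∑ i, ‖a i‖ ^ 2 : ℝ) : ℂ) * ((∑ i, ‖b i‖ ^ 2 : ℝ) : ℂ) := by
  rw [Matrix.trace_kronecker, Matrix.trace_vecMulVec, Matrix.trace_vecMulVec]
  simp [dotProduct, Complex.mul_conj']

theorem EuclideanSpace.sum_norm_sq_eq_one {κ : Type} [Fintype κ] {a : EuclideanSpace ℂ κ}
    (ha : ‖a‖ = 1) : ∑ i, ‖a i‖ ^ 2 = 1 := by
  rw [← EuclideanSpace.norm_sq_eq, ha, one_pow]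

/-! ### Repeated fingerprinting as an SMP protocol. -/

namespace FingerprintProtocol
variable {X Y : Type} (F : FingerprintProtocol X Y)

/-- The register holding `r` copies of a fingerprint. -/
def copiesEquiv : Fin (2 ^ (F.q * F.r)) ≃ (Fin F.r → Fin (2 ^ F.q)) :=
  Fintype.equivOfCardEq (by simp [pow_mul])

/-- Pairing up the copies of the two fingerprints. -/
def pairsEquiv : Fin (2 ^ (F.q * F.r)) × Fin (2 ^ (F.q * F.r)) ≃
    (Fin F.r → Fin (2 ^ F.q) × Fin (2 ^ F.q)) :=
  (F.copiesEquiv.prodCongr F.copiesEquiv).trans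
    (Equiv.arrowProdEquivProdArrow _ (fun _ => _) fun _ => _).symm

open Classical in
/-- The referee's accepting effect on the paired copies. -/
def referee : Matrix (Fin F.r → Fin (2 ^ F.q) × Fin (2 ^ F.q))
    (Fin F.r → Fin (2 ^ F.q) × Fin (2 ^ F.q)) ℂ :=
  ∑ z : Fin F.r → Bool, if F.τ ≤ F.estimate z
    then tensorFamily (fun i => swapProjection (Fin (2 ^ F.q)) (z i)) else 0

/-- The tensor products of swap-test projections sum to the identity over all outcome strings. The
referee's operator is the part of this sum over accepting strings, and its complement the part over
rejecting ones. -/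
theorem isEffect_referee : IsEffect F.referee := by
  have hp : ∀ z : Fin F.r → Bool,
      (tensorFamily fun i => swapProjection (Fin (2 ^ F.q)) (z i)).PosSemidef :=
    fun z => posSemidef_tensorFamily fun i => swapProjection_isProjection _
  have h1 : (1 : Matrix (Fin F.r → Fin (2 ^ F.q) × Fin (2 ^ F.q)) _ ℂ) =
      ∑ z : Fin F.r → Bool, tensorFamily fun i => swapProjection (Fin (2 ^ F.q)) (z i) := by
    rw [sum_tensorFamily, sum_swapProjection, tensorFamily_one]
  constructor
  · refine Matrix.posSemidef_sum _ fun z _ => ?_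
    split_ifs
    · exact hp z
    · exact Matrix.PosSemidef.zero
  · rw [h1, referee, ← Finset.sum_sub_distrib]
    refine Matrix.posSemidef_sum _ fun z _ => ?_
    split_ifs
    · rw [sub_self]; exact Matrix.PosSemidef.zero
    · rw [sub_zero]; exact hp z

/-- `r` copies of a pure state. -/
def copies (a : EuclideanSpace ℂ (Fin (2 ^ F.q))) :
    Matrix (Fin (2 ^ (F.q * F.r))) (Fin (2 ^ (F.q * F.r))) ℂ :=
  (tensorFamily fun _ : Fin F.r => Matrix.vecMulVec (fun i => a i) (star fun i => a i)).submatrix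
    F.copiesEquiv F.copiesEquiv

theorem isDensity_copies {a : EuclideanSpace ℂ (Fin (2 ^ F.q))} (ha : ‖a‖ = 1) :
    IsDensity (F.copies a) := by
  constructor
  · rw [copies, tensorFamily_vecMulVec]
    exact (Matrix.posSemidef_vecMulVec_self_star _).submatrix _
  · have h : (F.copies a).trace =
        (tensorFamily fun _ : Fin F.r =>
          Matrix.vecMulVec (fun i => a i) (star fun i => a i)).trace :=
      F.copiesEquiv.sum_comp fun i => tensorFamily (fun _ : Fin F.r =>
          Matrix.vecMulVec (fun i => a i) (star fun i => a i)) i i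
    have h1 := EuclideanSpace.sum_norm_sq_eq_one ha
    have h2 : (Matrix.vecMulVec (fun i => a i) (star fun i => a i)).trace = 1 := by
      rw [Matrix.trace_vecMulVec]
      simp only [dotProduct, Pi.star_apply, RCLike.star_def, Complex.mul_conj']
      exact_mod_cast h1
    rw [h, trace_tensorFamily, h2, Finset.prod_const_one]

theorem trace_swapProjection_mul (x : X) (y : Y) (z : Bool) :
    (swapProjection (Fin (2 ^ F.q)) z *
      (Matrix.vecMulVec (fun i => F.α x i) (star fun i => F.α x i) ⊗ₖ
        Matrix.vecMulVec (fun i => F.β y i) (star fun i => F.β y i))).trace =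
      (F.swapTest x y z : ℂ) := by
  have hi : star (fun i => F.α x i) ⬝ᵥ (fun i => F.β y i) = inner ℂ (F.α x) (F.β y) := by
    simp [dotProduct, PiLp.inner_apply, mul_comm]
  rw [swapProjection, Matrix.smul_mul, add_mul, one_mul, Matrix.smul_mul, Matrix.trace_smul,
    Matrix.trace_add, Matrix.trace_smul, trace_swapMatrix_mul, trace_vecMulVec_kronecker,
    EuclideanSpace.sum_norm_sq_eq_one (F.norm_α x),
    EuclideanSpace.sum_norm_sq_eq_one (F.norm_β y), hi]
  cases z <;> simp [swapTest] <;> ring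

/-- A repeated fingerprinting protocol is a quantum SMP protocol. -/
def toSMPProtocol : SMPProtocol X Y where
  a := F.q * F.r
  b := F.q * F.r
  ρ x := F.copies (F.α x)
  σ y := F.copies (F.β y)
  isDensity_ρ x := F.isDensity_copies (F.norm_α x)
  isDensity_σ y := F.isDensity_copies (F.norm_β y)
  E := F.referee.submatrix F.pairsEquiv F.pairsEquiv
  isEffect_E := by
    refine ⟨F.isEffect_referee.1.submatrix _, ?_⟩
    have := F.isEffect_referee.2.submatrix F.pairsEquiv
    rwa [Matrix.submatrix_sub, Pi.sub_apply, Pi.sub_apply, Matrix.submatrix_one_equiv] at this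

theorem cost_toSMPProtocol : F.toSMPProtocol.cost = F.cost := by
  simp only [SMPProtocol.cost, toSMPProtocol, cost]
  ring

/-- Regrouped in pairs, the messages form the `r`-th tensor power of one fingerprint pair, so each
outcome's trace is a product of single swap-test probabilities. -/
theorem accept_toSMPProtocol (x : X) (y : Y) : F.toSMPProtocol.accept x y = F.accept x y := by
  set M := Matrix.vecMulVec (fun i => F.α x i) (star fun i => F.α x i) ⊗ₖ
    Matrix.vecMulVec (fun i => F.β y i) (star fun i => F.β y i) with hM
  have h1 : F.copies (F.α x) ⊗ₖ F.copies (F.β y) =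
      (tensorFamily fun _ : Fin F.r => M).submatrix F.pairsEquiv F.pairsEquiv := by
    ext p p'
    simp only [copies, tensorFamily, pairsEquiv, Matrix.kroneckerMap_apply,
      Matrix.submatrix_apply, Matrix.of_apply, ← Finset.prod_mul_distrib, hM]
    rfl
  have h2 : (F.referee * tensorFamily fun _ : Fin F.r => M).trace = (F.accept x y : ℂ) := by
    rw [referee, Finset.sum_mul, Matrix.trace_sum, accept, Complex.ofReal_sum]
    refine Finset.sum_congr rfl fun z _ => ?_
    split_ifs
    · rw [tensorFamily_mul, trace_tensorFamily, Complex.ofReal_prod]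
      exact Finset.prod_congr rfl fun i _ => F.trace_swapProjection_mul x y (z i)
    · simp
  have h3 : (F.toSMPProtocol.E * (F.toSMPProtocol.ρ x ⊗ₖ F.toSMPProtocol.σ y)).trace =
      (F.referee * tensorFamily fun _ : Fin F.r => M).trace := by
    change (F.referee.submatrix F.pairsEquiv F.pairsEquiv *
      (F.copies (F.α x) ⊗ₖ F.copies (F.β y))).trace = _
    rw [h1, Matrix.submatrix_mul_equiv]
    exact F.pairsEquiv.sum_comp fun i => (F.referee * tensorFamily fun _ : Fin F.r => M) i i
  rw [SMPProtocol.accept, h3, h2, Complex.ofReal_re]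

end FingerprintProtocol

/-! ### Choice of parameters and assembly. -/

theorem clog_two_le_logb_add_one {n : ℕ} (hn : 2 ≤ n) :
    (Nat.clog 2 n : ℝ) ≤ Real.logb 2 n + 1 := by
  have h := Real.natCeil_logb_natCast 2 n
  rw [← h]
  refine (Nat.ceil_lt_add_one ?_).le
  refine Real.logb_nonneg (by norm_num) ?_
  exact_mod_cast (by omega : 1 ≤ n)

theorem one_le_logb_two {n : ℕ} (hn : 2 ≤ n) : 1 ≤ Real.logb 2 n := by
  rw [Real.le_logb_iff_rpow_le (by norm_num) (by positivity), Real.rpow_one]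
  exact_mod_cast hn

/-- `1024 n 4^c` samples of the shared randomness make the error of Hoeffding's inequality small
enough for a union bound over all pairs of `n`-bit inputs. -/
theorem four_pow_mul_exp_lt_one {n c T : ℕ} (hn : 2 ≤ n) (hT : T = 1024 * n * 4 ^ c) :
    (2 : ℝ) ^ n * 2 ^ n *
      (2 * Real.exp (-(2 * T * (1 / 24 : ℝ) ^ 2 / ((2 : ℝ) ^ c) ^ 2))) < 1 := by
  have h4 : ((2 : ℝ) ^ c) ^ 2 = 4 ^ c := by rw [← pow_mul, mul_comm, pow_mul]; norm_num
  have hn' : (2 : ℝ) ≤ n := by exact_mod_cast hn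
  -- The `4 ^ c` in `T` cancels the squared range, and `2 * 1024 / 24 ^ 2 = 32 / 9`; this beats the
  -- exponent `2 * n + 1` of the union bound once `n ≥ 2`.
  have e : 2 * (T : ℝ) * (1 / 24 : ℝ) ^ 2 / ((2 : ℝ) ^ c) ^ 2 = 32 / 9 * n := by
    rw [h4, hT]; push_cast; field_simp; norm_num
  have h2 : (2 : ℝ) ≤ Real.exp 1 := by linarith [Real.add_one_le_exp (1 : ℝ)]
  have h3 : (2 : ℝ) ^ (2 * n + 1) ≤ Real.exp (2 * n + 1) := by
    calc (2 : ℝ) ^ (2 * n + 1) ≤ Real.exp 1 ^ (2 * n + 1) := by gcongr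
      _ = _ := by rw [← Real.exp_nat_mul]; congr 1; push_cast; ring
  rw [e]
  calc (2 : ℝ) ^ n * 2 ^ n * (2 * Real.exp (-(32 / 9 * n)))
      = 2 ^ (2 * n + 1) * Real.exp (-(32 / 9 * n)) := by ring
    _ ≤ Real.exp (2 * n + 1) * Real.exp (-(32 / 9 * n)) := by gcongr
    _ = Real.exp (2 * n + 1 - 32 / 9 * n) := by rw [← Real.exp_add]; congr 1
    _ < Real.exp 0 := Real.exp_lt_exp.mpr (by linarith)
    _ = 1 := Real.exp_zero

/-- Fingerprints whose inner products approximate the acceptance probabilities of a protocol with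
shared randomness, scaled down by `2 ^ c`. -/
theorem SharedRandomnessProtocol.exists_fingerprints {n : ℕ} (hn : 2 ≤ n)
    (P : SharedRandomnessProtocol (Fin n → Bool) (Fin n → Bool)) {c : ℕ} (hc : P.cost = c) :
    ∃ (α β : (Fin n → Bool) → EuclideanSpace ℂ (Fin (2 ^ (11 + 4 * c + Nat.clog 2 n)))),
      (∀ x, ‖α x‖ = 1) ∧ (∀ y, ‖β y‖ = 1) ∧ ∀ x y, ∃ p : ℝ, 0 ≤ p ∧
        |p - P.accept x y| < 1 / 24 ∧ inner ℂ (α x) (β y) = ((p / 2 ^ c : ℝ) : ℂ) := by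
  let _ := P.measurableSpace
  have := P.isProbabilityMeasure
  have hcost : ∀ r, (P.run r).cost ≤ c := fun r => hc ▸ P.cost_run_le r
  obtain ⟨T, hT⟩ : ∃ T, T = 1024 * n * 4 ^ c := ⟨_, rfl⟩
  have hT0 : 0 < T := by rw [hT]; positivity
  obtain ⟨s, hs⟩ := exists_sample_mean_near_integral P.μ
    (fun (i : (Fin n → Bool) × (Fin n → Bool)) r => (P.run r).accept i.1 i.2)
    (fun i => P.measurable_accept i.1 i.2) (N := 2 ^ c) (δ := 1 / 24) (by positivity)
    (by norm_num) (fun i r => (P.run r).accept_mem_Icc (hcost r) _ _) hT0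
    (by simpa using four_pow_mul_exp_lt_one hn hT)
  obtain ⟨κ, hκ, u, v, hcard, hu, hv, h⟩ := exists_average_factorization hT0
    (fun t => P.run (s t)) fun t => hcost _
  -- The dimension is at most `1024 * n * 16 ^ c`; doubling the constant to `2 ^ 11` makes room for
  -- the two extra coordinates.
  have hD : Fintype.card κ + 2 ≤ 2 ^ (11 + 4 * c + Nat.clog 2 n) := by
    have h1 : n ≤ 2 ^ Nat.clog 2 n := Nat.le_pow_clog (by norm_num) n
    have h2 : T * 4 ^ c = 1024 * (16 ^ c * n) := by
      rw [hT, show 16 = 4 * 4 by norm_num, mul_pow]; ring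
    have h3 : 2 ^ (11 + 4 * c + Nat.clog 2 n) = 2048 * (16 ^ c * 2 ^ Nat.clog 2 n) := by
      rw [pow_add, pow_add, pow_mul]; norm_num [mul_assoc]
    have h4 : 16 ^ c * n ≤ 16 ^ c * 2 ^ Nat.clog 2 n := Nat.mul_le_mul_left _ h1
    have h5 : 0 < 16 ^ c * n := by positivity
    rw [h3]
    rw [h2] at hcard
    omega
  obtain ⟨α, β, hα, hβ, hαβ⟩ := exists_unit_vectors u v hu hv hD
  refine ⟨α, β, hα, hβ, fun x y => ⟨(∑ t, (P.run (s t)).accept x y) / T, ?_, hs (x, y), ?_⟩⟩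
  · exact div_nonneg (Finset.sum_nonneg fun t _ =>
      ((P.run (s t)).accept_mem_Icc (hcost _) x y).1) (Nat.cast_nonneg _)
  · rw [hαβ, h]

/-- Repeated fingerprinting simulates shared randomness and interaction. -/
theorem SharedRandomnessProtocol.exists_fingerprintProtocol {n : ℕ} (hn : 2 ≤ n) {ε : ℝ}
    (hε : 0 < ε) (f : (Fin n → Bool) → (Fin n → Bool) → Bool)
    (P : SharedRandomnessProtocol (Fin n → Bool) (Fin n → Bool))
    (hP : ComputesWithError P.accept f (1 / 3)) :
    ∃ F : FingerprintProtocol (Fin n → Bool) (Fin n → Bool),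
      ComputesWithError F.accept f ε ∧
      (F.cost : ℝ) ≤ 26 * (100 / ε + 1) * 2 ^ (8 * P.cost) * Real.logb 2 n := by
  obtain ⟨c, hc⟩ : ∃ c, P.cost = c := ⟨_, rfl⟩
  obtain ⟨α, β, hα, hβ, h⟩ := P.exists_fingerprints hn hc
  rw [hc]
  obtain ⟨r, hr⟩ : ∃ r, r = ⌈100 * 16 ^ c / ε⌉₊ := ⟨_, rfl⟩
  have hr1 : 100 * 16 ^ c / ε ≤ r := by rw [hr]; exact Nat.le_ceil _
  have hr0 : 0 < r := by rw [hr]; exact Nat.ceil_pos.mpr (by positivity)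
  have hr0' : (0 : ℝ) < r := by exact_mod_cast hr0
  have hδ : (0 : ℝ) < 1 / 10 / 4 ^ c := by positivity
  have herr : 1 / (r : ℝ) / (1 / 10 / 4 ^ c) ^ 2 ≤ ε := by
    have h16 : ((4 : ℝ) ^ c) ^ 2 = 16 ^ c := by rw [← pow_mul, mul_comm, pow_mul]; norm_num
    have : 1 / (r : ℝ) / (1 / 10 / 4 ^ c) ^ 2 = 100 * 16 ^ c / r := by
      rw [← h16]; field_simp; norm_num
    rw [this, div_le_iff₀ hr0']
    rw [mul_comm ε]
    rwa [div_le_iff₀ hε] at hr1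
  -- Up to the factor `4 ^ c`: accepted inputs have `p ≥ 2/3 - 1/24 = 5/8`, so `p ^ 2 ≥ 25/64 > 1/4
  -- + 1/10`; rejected ones have `0 ≤ p ≤ 3/8`, so `p ^ 2 ≤ 9/64 < 1/4 - 1/10`.
  let F : FingerprintProtocol (Fin n → Bool) (Fin n → Bool) :=
    ⟨11 + 4 * c + Nat.clog 2 n, r, α, β, hα, hβ, 1 / 4 / 4 ^ c⟩
  have hinner : ∀ x y, ∃ p : ℝ, 0 ≤ p ∧ |p - P.accept x y| < 1 / 24 ∧
      ‖inner ℂ (F.α x) (F.β y)‖ ^ 2 = p ^ 2 / 4 ^ c := fun x y => by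
    obtain ⟨p, hp0, hp, hpi⟩ := h x y
    refine ⟨p, hp0, hp, ?_⟩
    change ‖inner ℂ (α x) (β y)‖ ^ 2 = _
    rw [hpi, Complex.norm_real, Real.norm_eq_abs, sq_abs, div_pow, ← pow_mul, mul_comm c 2, pow_mul]
    norm_num
  refine ⟨F, fun x y => ⟨fun hf => ?_, fun hf => ?_⟩, ?_⟩
  · obtain ⟨p, -, hp, hpi⟩ := hinner x y
    have hacc := (hP x y).1 hf
    refine le_trans (by linarith) (F.le_accept hδ hr0 ?_)
    rw [hpi]
    change 1 / 4 / 4 ^ c + 1 / 10 / 4 ^ c ≤ _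
    rw [← add_div]
    gcongr
    have := (abs_lt.mp hp).1
    nlinarith
  · obtain ⟨p, hp0, hp, hpi⟩ := hinner x y
    have hacc := (hP x y).2 hf
    refine (F.accept_le hδ hr0 ?_).trans herr
    rw [hpi]
    change _ ≤ 1 / 4 / 4 ^ c
    rw [← add_div]
    gcongr
    have := (abs_lt.mp hp).2
    nlinarith
  · have hL := one_le_logb_two hn
    have hclog := clog_two_le_logb_add_one hn
    set L := Real.logb 2 n
    have h16 : (1 : ℝ) ≤ 16 ^ c := one_le_pow₀ (by norm_num)
    -- The term linear in `c` in the fingerprint length is bounded by `16 ^ c`; the other factor `16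
    -- ^ c` of `2 ^ (8 * c)` comes from `r`.
    have hc16 : (c : ℝ) + 1 ≤ 16 ^ c := by
      have := one_add_mul_le_pow (by norm_num : (-2 : ℝ) ≤ 15) c
      norm_num at this
      nlinarith [Nat.cast_nonneg (α := ℝ) c]
    have hq : ((11 + 4 * c + Nat.clog 2 n : ℕ) : ℝ) ≤ 13 * 16 ^ c * L := by
      push_cast
      calc (11 : ℝ) + 4 * c + Nat.clog 2 n ≤ (13 + 4 * c) * L := by
            nlinarith [Nat.cast_nonneg (α := ℝ) c]
        _ ≤ 13 * 16 ^ c * L := by gcongr; linarith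
    have hrle : (r : ℝ) ≤ (100 / ε + 1) * 16 ^ c := by
      rw [hr]
      refine (Nat.ceil_lt_add_one (by positivity)).le.trans ?_
      rw [add_mul, one_mul, div_mul_eq_mul_div]
      gcongr
    have hcost : (F.cost : ℝ) = 2 * ((11 + 4 * c + Nat.clog 2 n : ℕ) : ℝ) * r := by
      simp only [FingerprintProtocol.cost, F]; push_cast; ring
    calc (F.cost : ℝ) = 2 * ((11 + 4 * c + Nat.clog 2 n : ℕ) : ℝ) * r := hcost
      _ ≤ 2 * (13 * 16 ^ c * L) * ((100 / ε + 1) * 16 ^ c) := by gcongr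
      _ = 26 * (100 / ε + 1) * (16 ^ c * 16 ^ c) * L := by ring
      _ = 26 * (100 / ε + 1) * 2 ^ (8 * c) * L := by
          rw [← mul_pow, pow_mul]; norm_num

end

theorem theorem1 :
    (∃ C : ℝ, ∀ n : ℕ, 2 ≤ n → ∀ f : (Fin n → Bool) → (Fin n → Bool) → Bool,
      (Qsmp f : ℝ) ≤ C * 2 ^ (8 * Qpub f) * Real.logb 2 n) ∧
    (∀ ε : ℝ, 0 < ε → ∃ C : ℝ, ∀ n : ℕ, 2 ≤ n →
      ∀ f : (Fin n → Bool) → (Fin n → Bool) → Bool,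
      ∀ P : SharedRandomnessProtocol (Fin n → Bool) (Fin n → Bool),
        ComputesWithError P.accept f (1 / 3) →
        ∃ F : FingerprintProtocol (Fin n → Bool) (Fin n → Bool),
          ComputesWithError F.accept f ε ∧
          (F.cost : ℝ) ≤ C * 2 ^ (8 * P.cost) * Real.logb 2 n) := by
  constructor
  · refine ⟨26 * (100 / (1 / 3 : ℝ) + 1), fun n hn f => ?_⟩
    obtain ⟨P, hcost, hP⟩ : ∃ P : SharedRandomnessProtocol (Fin n → Bool) (Fin n → Bool),
        P.cost = Qpub f ∧ ComputesWithError P.accept f (1 / 3) :=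
      Nat.sInf_mem (s := {q | ∃ P : SharedRandomnessProtocol (Fin n → Bool) (Fin n → Bool),
        P.cost = q ∧ ComputesWithError P.accept f (1 / 3)})
        (let ⟨P, hP⟩ := exists_SharedRandomnessProtocol f; ⟨n, P, hP⟩)
    obtain ⟨F, hF, hFc⟩ := P.exists_fingerprintProtocol hn (ε := 1 / 3) (by norm_num) f hP
    rw [hcost] at hFc
    refine le_trans (Nat.cast_le.mpr (Nat.sInf_le ⟨F.toSMPProtocol, F.cost_toSMPProtocol, ?_⟩)) hFc
    intro x y
    rw [F.accept_toSMPProtocol]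
    exact hF x y
  · exact fun ε hε => ⟨26 * (100 / ε + 1), fun n hn f P hP =>
      P.exists_fingerprintProtocol hn hε f hP⟩
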